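/- Let $\mathcal H$ be a complex Hilbert space, $\mathcal B(\mathcal H)$ the bounded operators with operator norm $\|\cdot\|$, and $\mathcal T(\mathcal H)$ the trace class operators with trace norm $\|T\|_1=\mathrm{tr}|T|$. For $\alpha\in\mathbb R$ write $X\circ_\alpha Y:=\alpha XY+(1-\alpha)YX$. A (positive) instrument $M=\{M_m\}_m$ is a family of positive bounded linear maps $M_m:\mathcal T(\mathcal H)\to\mathcal T(\mathcal H)$ such that $\Lambda_M(\sigma):=\sum_m M_m(\sigma)$ converges in trace norm and $\mathrm{tr}\,\Lambda_M(\sigma)=\mathrm{tr}\,\sigma$ for every $\sigma\in\mathcal T(\mathcal H)$. Its POVM $E_M=\{E_M(m)\}_m\subset\mathcal B(\mathcal H)$ is given by $\mathrm{tr}[\sigma E_M(m)]=\mathrm{tr}[M_m(\sigma)]$ for all $\sigma\in\mathcal T(\mathcal H)$. Its invasiveness in the state $\rho$ is $\mathrm{Inv}_M(\rho):=\|\Lambda_M(\rho)-\rho\|_1$. Let $M=\{M_m\}_m$ and $N=\{N_n\}_n$ be instruments, let $\rho\in\mathcal T(\mathcal H)$ be a state ($\rho\ge 0$, $\mathrm{tr}\,\rho=1$),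 and let $\alpha\in\mathbb R$. Let $P_\rho^{M\to N}(m,n):=\mathrm{tr}[N_n(M_m(\rho))]$ be the operational joint probability of the sequential measurement of $M$ and then $N$, and let $P_\rho^{\alpha}(m,n):=\mathrm{tr}\bigl[\rho\,\bigl(E_M(m)\circ_\alpha E_N(n)\bigr)\bigr]$ be the algebraic quasi-joint probability. Then for all outcomes $m,n$, $$\bigl|P_\rho^{M\to N}(m,n)-P_\rho^{\alpha}(m,n)\bigr|\le \|E_M(m)\circ_\alpha E_N(n)\|\;\mathrm{Inv}_M(\rho)+\|E_N(n)\|\;\Bigl\|M_m(\rho)\circ_\alpha\!\sum_{m'\ne m}E_M(m')\;-\;\sum_{m'\ne m}M_{m'}(\rho)\circ_\alpha E_M(m)\Bigr\|_1 .$$ (The sum of the $E_M(m')$ converges in the weak operator topology, that of the $M_{m'}(\rho)$ in trace norm.) -/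

import Mathlib

open scoped ENNReal InnerProductSpace InnerProduct

namespace QuantumCorr

section TraceNorm

variable {H : Type*} [NormedAddCommGroup H] [InnerProductSpace ℂ H] [CompleteSpace H]

/-- Index set of a fixed orthonormal (Hilbert) basis of `H`. -/
noncomputable def basisIdx (H : Type*) [NormedAddCommGroup H] [InnerProductSpace ℂ H]
    [CompleteSpace H] : Set H := (exists_hilbertBasis ℂ H).choose

/-- A fixed orthonormal (Hilbert) basis of `H`, used to write down traces. -/
noncomputable def stdBasis (H : Type*) [NormedAddCommGroup H] [InnerProductSpace ℂ H]
    [CompleteSpace H] : HilbertBasis (basisIdx H) ℂ H :=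
  (exists_hilbertBasis ℂ H).choose_spec.choose

/-- The trace norm `‖T‖₁ = tr |T| ∈ [0, ∞]` of a bounded operator, with `|T| = √(T* T)`. -/
noncomputable def traceENorm (T : H →L[ℂ] H) : ℝ≥0∞ :=
  ∑' i, ENNReal.ofReal (Complex.re ⟪stdBasis H i, CFC.abs T (stdBasis H i)⟫_ℂ)

/-- Squared Hilbert-Schmidt norm (auxiliary). -/
noncomputable def hsq (S : H →L[ℂ] H) : ℝ≥0∞ := ∑' i, ‖S (stdBasis H i)‖ₑ ^ 2

theorem enorm_sq_eq_tsum (x : H) : ‖x‖ₑ ^ 2 = ∑' i, ‖⟪stdBasis H i, x⟫_ℂ‖ₑ ^ 2 := by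
  have h := (stdBasis H).hasSum_inner_mul_inner x x
  have h2 : HasSum (fun i => ‖⟪stdBasis H i, x⟫_ℂ‖ ^ 2) (‖x‖ ^ 2) := by
    have h3 := h.mapL Complex.reCLM
    convert h3 using 1
    · funext i
      rw [← inner_conj_symm x, mul_comm]
      simp only [Complex.reCLM_apply, Complex.mul_conj, Complex.ofReal_re, Complex.normSq_eq_norm_sq]
    · rw [inner_self_eq_norm_sq_to_K]
      simp [← Complex.ofReal_pow]
  have h4 := ENNReal.ofReal_tsum_of_nonneg (fun i => by positivity) h2.summable
  rw [h2.tsum_eq] at h4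
  simp only [← ofReal_norm, ← ENNReal.ofReal_pow (norm_nonneg _)]
  exact h4

theorem hsq_adjoint (S : H →L[ℂ] H) : hsq (star S) = hsq S := by
  unfold hsq
  rw [tsum_congr fun i => enorm_sq_eq_tsum ((star S) (stdBasis H i)),
    tsum_congr fun i => enorm_sq_eq_tsum (S (stdBasis H i)), ENNReal.tsum_comm]
  refine tsum_congr fun i => tsum_congr fun j => ?_
  rw [ContinuousLinearMap.star_eq_adjoint, ContinuousLinearMap.adjoint_inner_right,
    ← ofReal_norm, ← ofReal_norm, norm_inner_symm]

theorem hsq_mul_left (A S : H →L[ℂ] H) : hsq (A * S) ≤ ‖A‖ₑ ^ 2 * hsq S := by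
  unfold hsq
  rw [← ENNReal.tsum_mul_left]
  refine ENNReal.tsum_le_tsum fun i => ?_
  rw [← mul_pow]
  gcongr
  exact A.le_opENorm _

theorem hsq_mul_right (S A : H →L[ℂ] H) : hsq (S * A) ≤ ‖A‖ₑ ^ 2 * hsq S := by
  rw [← hsq_adjoint, star_mul]
  refine (hsq_mul_left _ _).trans ?_
  rw [hsq_adjoint]
  simp [← ofReal_norm]

/-- The square root of `|T|` (auxiliary). -/
noncomputable def rootAbs (T : H →L[ℂ] H) : H →L[ℂ] H := CFC.sqrt (CFC.abs T)

theorem rootAbs_star (T : H →L[ℂ] H) : star (rootAbs T) = rootAbs T :=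
  (CFC.sqrt_nonneg (CFC.abs T)).isSelfAdjoint

theorem rootAbs_mul (T : H →L[ℂ] H) : rootAbs T * rootAbs T = CFC.abs T :=
  CFC.sqrt_mul_sqrt_self _ (CFC.abs_nonneg T)

theorem inner_mul_rootAbs (T A B : H →L[ℂ] H) (x y : H) :
    ⟪x, (A * CFC.abs T * B) y⟫_ℂ = ⟪(rootAbs T * star A) x, (rootAbs T * B) y⟫_ℂ := by
  rw [← rootAbs_mul T]
  have : A * (rootAbs T * rootAbs T) * B = star (rootAbs T * star A) * (rootAbs T * B) := by
    rw [star_mul, star_star, rootAbs_star]; simp only [mul_assoc]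
  rw [this, mul_apply_eq_comp, ContinuousLinearMap.star_eq_adjoint,
    ContinuousLinearMap.adjoint_inner_right]

theorem traceENorm_eq_hsq (T : H →L[ℂ] H) : traceENorm T = hsq (rootAbs T) := by
  unfold traceENorm hsq
  refine tsum_congr fun i => ?_
  have h := inner_mul_rootAbs T 1 1 (stdBasis H i) (stdBasis H i)
  simp only [one_mul, mul_one, star_one] at h
  rw [h, inner_self_eq_norm_sq_to_K, ← ofReal_norm, ← ENNReal.ofReal_pow (norm_nonneg _)]
  congr 1
  simp [← Complex.ofReal_pow]

theorem tsum_enorm_inner_le (T A B : H →L[ℂ] H) :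
    ∑' i, ‖⟪stdBasis H i, (A * CFC.abs T * B) (stdBasis H i)⟫_ℂ‖ₑ
      ≤ (‖A‖ₑ ^ 2 + ‖B‖ₑ ^ 2) / 2 * traceENorm T := by
  have h1 : ∀ i, ‖⟪stdBasis H i, (A * CFC.abs T * B) (stdBasis H i)⟫_ℂ‖ₑ
      ≤ (‖(rootAbs T * star A) (stdBasis H i)‖ₑ ^ 2 + ‖(rootAbs T * B) (stdBasis H i)‖ₑ ^ 2) / 2 := by
    intro i
    rw [inner_mul_rootAbs]
    set u := (rootAbs T * star A) (stdBasis H i)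
    set v := (rootAbs T * B) (stdBasis H i)
    have h := norm_inner_le_norm (𝕜 := ℂ) u v
    have h2 : ‖⟪u, v⟫_ℂ‖ ≤ (‖u‖ ^ 2 + ‖v‖ ^ 2) / 2 := by nlinarith [sq_nonneg (‖u‖ - ‖v‖)]
    simp only [← ofReal_norm, ← ENNReal.ofReal_pow (norm_nonneg _)]
    rw [← ENNReal.ofReal_add (by positivity) (by positivity)]
    refine (ENNReal.ofReal_le_ofReal h2).trans ?_
    rw [ENNReal.ofReal_div_of_pos (by norm_num)]
    simp
  refine (ENNReal.tsum_le_tsum h1).trans ?_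
  simp only [div_eq_mul_inv]
  rw [ENNReal.tsum_mul_right, ENNReal.tsum_add]
  have h2 := hsq_mul_right (rootAbs T) (star A)
  have h3 := hsq_mul_right (rootAbs T) B
  rw [← traceENorm_eq_hsq] at h2 h3
  have h4 : ‖star A‖ₑ = ‖A‖ₑ := by simp [← ofReal_norm]
  rw [h4] at h2
  calc _ ≤ (‖A‖ₑ ^ 2 * traceENorm T + ‖B‖ₑ ^ 2 * traceENorm T) * 2⁻¹ := by
        gcongr <;> assumption
    _ = _ := by ring

/-- If `‖S x‖ ≤ ‖T x‖` for all `x`, then `S` factors through `T` by a contraction. -/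
theorem exists_contraction (S T : H →L[ℂ] H) (h : ∀ x, ‖S x‖ ≤ ‖T x‖) :
    ∃ U : H →L[ℂ] H, ‖U‖ ≤ 1 ∧ S = U * T := by
  let K : Submodule ℂ H := (LinearMap.range T.toLinearMap).topologicalClosure
  have hmem : ∀ x, T x ∈ K := fun x => Submodule.le_topologicalClosure _ ⟨x, rfl⟩
  let e : H →ₗ[ℂ] K := T.toLinearMap.codRestrict K hmem
  have : CompleteSpace K := (Submodule.isClosed_topologicalClosure _).completeSpace_coe
  have hd : DenseRange e := by
    intro y
    rw [Metric.mem_closure_iff]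
    intro ε hε
    have hy : (y : H) ∈ closure ((LinearMap.range T.toLinearMap : Submodule ℂ H) : Set H) := y.2
    obtain ⟨z, ⟨x, rfl⟩, hx⟩ := Metric.mem_closure_iff.1 hy ε hε
    exact ⟨e x, ⟨x, rfl⟩, hx⟩
  have hn : ∀ x, ‖S.toLinearMap x‖ ≤ 1 * ‖e x‖ := fun x => by
    rw [one_mul]; exact h x
  refine ⟨(S.toLinearMap.extendOfNorm e) ∘L K.orthogonalProjectionOnto, ?_, ?_⟩
  · refine (ContinuousLinearMap.opNorm_comp_le _ _).trans ?_
    have h1 := LinearMap.opNorm_extendOfNorm_le (f := S.toLinearMap) hd zero_le_one hn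
    have h2 := K.orthogonalProjectionOnto_norm_le
    exact mul_le_one₀ h1 (norm_nonneg _) h2
  · ext x
    have h1 : K.orthogonalProjectionOnto (T x) = e x :=
      K.orthogonalProjectionOnto_mem_subspace_eq_self ⟨T x, hmem x⟩
    simp only [mul_apply_eq_comp, ContinuousLinearMap.comp_apply, h1]
    exact (LinearMap.extendOfNorm_eq hd ⟨1, hn⟩ x).symm

theorem norm_abs_apply (T : H →L[ℂ] H) (x : H) : ‖CFC.abs T x‖ = ‖T x‖ := by
  have h : ∀ S : H →L[ℂ] H, ‖S x‖ ^ 2 = Complex.re ⟪x, (star S * S) x⟫_ℂ := by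
    intro S
    rw [mul_apply_eq_comp, ContinuousLinearMap.star_eq_adjoint,
      ContinuousLinearMap.adjoint_inner_right, inner_self_eq_norm_sq_to_K]
    simp [← Complex.ofReal_pow]
  have h2 : ‖CFC.abs T x‖ ^ 2 = ‖T x‖ ^ 2 := by
    rw [h, h, (CFC.abs_nonneg T).isSelfAdjoint.star_eq, CFC.abs_mul_abs]
  exact (sq_eq_sq₀ (norm_nonneg _) (norm_nonneg _)).1 h2

theorem exists_eq_mul_abs (T : H →L[ℂ] H) :
    ∃ U : H →L[ℂ] H, ‖U‖ ≤ 1 ∧ T = U * CFC.abs T :=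
  exists_contraction _ _ fun x => (norm_abs_apply T x).ge

theorem exists_abs_eq_mul (T : H →L[ℂ] H) :
    ∃ U : H →L[ℂ] H, ‖U‖ ≤ 1 ∧ CFC.abs T = U * T :=
  exists_contraction _ _ fun x => (norm_abs_apply T x).le

theorem enorm_le_one_of {H : Type*} [NormedAddCommGroup H] [InnerProductSpace ℂ H] {A : H →L[ℂ] H} (h : ‖A‖ ≤ 1) : ‖A‖ₑ ≤ 1 := by
  rw [← ofReal_norm]; exact ENNReal.ofReal_le_one.2 h

theorem traceENorm_le_tsum (T : H →L[ℂ] H) :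
    traceENorm T ≤ ∑' i, ‖⟪stdBasis H i, CFC.abs T (stdBasis H i)⟫_ℂ‖ₑ := by
  refine ENNReal.tsum_le_tsum fun i => ?_
  rw [← ofReal_norm]
  exact ENNReal.ofReal_le_ofReal (Complex.re_le_norm _)

theorem tsum_enorm_inner_le' (T V : H →L[ℂ] H) (hV : ‖V‖ ≤ 1) :
    ∑' i, ‖⟪stdBasis H i, (V * T) (stdBasis H i)⟫_ℂ‖ₑ ≤ traceENorm T := by
  obtain ⟨U, hU, hT⟩ := exists_eq_mul_abs T
  have h := tsum_enorm_inner_le T (V * U) 1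
  rw [mul_one, mul_assoc, ← hT] at h
  have h1 : ‖V * U‖ₑ ≤ 1 :=
    enorm_le_one_of ((norm_mul_le _ _).trans (mul_le_one₀ hV (norm_nonneg _) hU))
  have h2 : ‖(1 : H →L[ℂ] H)‖ₑ ≤ 1 := enorm_le_one_of ContinuousLinearMap.norm_id_le
  refine h.trans ?_
  calc _ ≤ ((1 : ℝ≥0∞) ^ 2 + 1 ^ 2) / 2 * traceENorm T := by gcongr
    _ = traceENorm T := by
      rw [one_pow, one_add_one_eq_two, ENNReal.div_self (by norm_num) (by norm_num), one_mul]

theorem traceENorm_add_le (S T : H →L[ℂ] H) :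
    traceENorm (S + T) ≤ traceENorm S + traceENorm T := by
  obtain ⟨V, hV, h⟩ := exists_abs_eq_mul (S + T)
  refine (traceENorm_le_tsum _).trans ?_
  rw [h, mul_add]
  calc _ ≤ ∑' i, (‖⟪stdBasis H i, (V * S) (stdBasis H i)⟫_ℂ‖ₑ
          + ‖⟪stdBasis H i, (V * T) (stdBasis H i)⟫_ℂ‖ₑ) := by
        refine ENNReal.tsum_le_tsum fun i => ?_
        rw [add_apply, inner_add_right]
        exact enorm_add_le _ _
    _ ≤ _ := by
        rw [ENNReal.tsum_add]
        exact add_le_add (tsum_enorm_inner_le' _ _ hV) (tsum_enorm_inner_le' _ _ hV)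

theorem traceENorm_smul (c : ℂ) (T : H →L[ℂ] H) :
    traceENorm (c • T) = ‖c‖ₑ * traceENorm T := by
  unfold traceENorm
  rw [← ENNReal.tsum_mul_left]
  refine tsum_congr fun i => ?_
  rw [CFC.abs_smul, ← ofReal_norm, ← ENNReal.ofReal_mul (norm_nonneg _)]
  congr 1
  rw [smul_apply, inner_smul_right_eq_smul]
  simp

theorem traceENorm_zero : traceENorm (0 : H →L[ℂ] H) = 0 := by
  simpa using traceENorm_smul 0 (0 : H →L[ℂ] H)

theorem eq_zero_of_traceENorm (T : H →L[ℂ] H) (h : traceENorm T = 0) : T = 0 := by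
  rw [traceENorm_eq_hsq, hsq, ENNReal.tsum_eq_zero] at h
  have h1 : rootAbs T = 0 := by
    have h2 : hsq (star (rootAbs T)) = 0 := by rw [hsq_adjoint, hsq]; simpa using h
    ext x
    have h3 : ‖rootAbs T x‖ₑ ^ 2 = 0 := by
      rw [enorm_sq_eq_tsum, ENNReal.tsum_eq_zero]
      intro i
      rw [← ContinuousLinearMap.adjoint_inner_left, ← ContinuousLinearMap.star_eq_adjoint,
        rootAbs_star]
      have := h i
      simp only [pow_eq_zero_iff, ne_eq, OfNat.ofNat_ne_zero, not_false_eq_true,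
        enorm_eq_zero] at this
      simp [this]
    simpa using h3
  rw [← CFC.abs_eq_zero_iff, ← rootAbs_mul, h1, zero_mul]

theorem traceENorm_mul_mul_ne_top (A B T : H →L[ℂ] H) (h : traceENorm T ≠ ∞) :
    traceENorm (A * T * B) ≠ ∞ := by
  obtain ⟨U, -, hT⟩ := exists_eq_mul_abs T
  obtain ⟨V, -, hV⟩ := exists_abs_eq_mul (A * T * B)
  have h1 := traceENorm_le_tsum (A * T * B)
  have h2 : CFC.abs (A * T * B) = (V * A * U) * CFC.abs T * B := by
    rw [hV]
    conv_lhs => rw [hT]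
    simp only [mul_assoc]
  rw [h2] at h1
  refine ne_top_of_le_ne_top ?_ (h1.trans (tsum_enorm_inner_le T _ B))
  refine ENNReal.mul_ne_top (ENNReal.div_ne_top ?_ (by norm_num)) h
  exact ENNReal.add_ne_top.2 ⟨by simp, by simp⟩

end TraceNorm

section TraceClassSpace

/-- The trace class operators `𝒯(H)`, as a linear subspace of `ℬ(H)`. -/
def traceClassSubmodule (H : Type*) [NormedAddCommGroup H] [InnerProductSpace ℂ H]
    [CompleteSpace H] : Submodule ℂ (H →L[ℂ] H) where
  carrier := {T | traceENorm T ≠ ∞}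
  zero_mem' := by simp [traceENorm_zero]
  add_mem' := fun {S T} hS hT =>
    ne_top_of_le_ne_top (ENNReal.add_ne_top.2 ⟨hS, hT⟩) (traceENorm_add_le S T)
  smul_mem' := fun c T hT => by
    rw [Set.mem_ofPred_eq, traceENorm_smul]
    exact ENNReal.mul_ne_top (by simp) hT

/-- The space `𝒯(H)` of trace class operators. It is a type synonym of the subspace above, because
it carries the trace norm and not the operator norm. -/
def TraceClass (H : Type*) [NormedAddCommGroup H] [InnerProductSpace ℂ H]
    [CompleteSpace H] : Type _ := traceClassSubmodule H

variable {H : Type*} [NormedAddCommGroup H] [InnerProductSpace ℂ H] [CompleteSpace H]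

noncomputable instance : AddCommGroup (TraceClass H) :=
  inferInstanceAs (AddCommGroup (traceClassSubmodule H))

noncomputable instance : Module ℂ (TraceClass H) :=
  inferInstanceAs (Module ℂ (traceClassSubmodule H))

/-- The bounded operator underlying a trace class operator. -/
def TraceClass.toCLM : TraceClass H →ₗ[ℂ] (H →L[ℂ] H) := (traceClassSubmodule H).subtype

theorem TraceClass.toCLM_injective : Function.Injective (TraceClass.toCLM (H := H)) :=
  Subtype.val_injective

theorem TraceClass.traceENorm_ne_top (T : TraceClass H) : traceENorm T.toCLM ≠ ∞ := T.2

/-- The trace norm `‖T‖₁ = tr |T|` on `𝒯(H)`. -/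
noncomputable instance : Norm (TraceClass H) := ⟨fun T => (traceENorm T.toCLM).toReal⟩

theorem TraceClass.norm_def (T : TraceClass H) : ‖T‖ = (traceENorm T.toCLM).toReal := rfl

theorem TraceClass.core : NormedSpace.Core ℂ (TraceClass H) where
  norm_nonneg _ := ENNReal.toReal_nonneg
  norm_smul c T := by
    rw [norm_def, map_smul, traceENorm_smul, ENNReal.toReal_mul]; simp [norm_def]
  norm_triangle S T := by
    rw [norm_def, norm_def, norm_def, map_add,
      ← ENNReal.toReal_add S.traceENorm_ne_top T.traceENorm_ne_top]
    exact ENNReal.toReal_mono (ENNReal.add_ne_top.2 ⟨S.traceENorm_ne_top, T.traceENorm_ne_top⟩)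
      (traceENorm_add_le _ _)
  norm_eq_zero_iff T := by
    constructor
    · intro h
      refine TraceClass.toCLM_injective ?_
      rw [map_zero]
      exact eq_zero_of_traceENorm _
        (((ENNReal.toReal_eq_zero_iff _).1 h).resolve_right T.traceENorm_ne_top)
    · rintro rfl
      rw [norm_def, map_zero, traceENorm_zero, ENNReal.toReal_zero]

noncomputable instance : NormedAddCommGroup (TraceClass H) :=
  NormedAddCommGroup.ofCore TraceClass.core

noncomputable instance : NormedSpace ℂ (TraceClass H) :=
  NormedSpace.ofCore TraceClass.core

/-- The product `A T` of a bounded operator and a trace class operator. -/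
noncomputable instance : HMul (H →L[ℂ] H) (TraceClass H) (TraceClass H) :=
  ⟨fun A T => ⟨A * T.toCLM, by
    have h := traceENorm_mul_mul_ne_top A 1 T.toCLM T.traceENorm_ne_top
    rwa [mul_one] at h⟩⟩

/-- The product `T A` of a trace class operator and a bounded operator. -/
noncomputable instance : HMul (TraceClass H) (H →L[ℂ] H) (TraceClass H) :=
  ⟨fun T A => ⟨T.toCLM * A, by
    have h := traceENorm_mul_mul_ne_top 1 A T.toCLM T.traceENorm_ne_top
    rwa [one_mul] at h⟩⟩

@[simp] theorem TraceClass.toCLM_lmul (A : H →L[ℂ] H) (T : TraceClass H) :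
    (A * T : TraceClass H).toCLM = A * T.toCLM := rfl

@[simp] theorem TraceClass.toCLM_rmul (T : TraceClass H) (A : H →L[ℂ] H) :
    (T * A : TraceClass H).toCLM = T.toCLM * A := rfl

theorem TraceClass.tsum_enorm_diag_le (T : TraceClass H) :
    ∑' i, ‖⟪stdBasis H i, T.toCLM (stdBasis H i)⟫_ℂ‖ₑ ≤ traceENorm T.toCLM := by
  have h := tsum_enorm_inner_le' T.toCLM 1 ContinuousLinearMap.norm_id_le
  rwa [one_mul] at h

theorem TraceClass.summable_norm_diag (T : TraceClass H) :
    Summable fun i => ‖⟪stdBasis H i, T.toCLM (stdBasis H i)⟫_ℂ‖ := by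
  have h := ENNReal.summable_toReal (ne_top_of_le_ne_top T.traceENorm_ne_top T.tsum_enorm_diag_le)
  simpa using h

/-- The trace `tr T = ∑ᵢ ⟨eᵢ, T eᵢ⟩`, a bounded linear functional on `𝒯(H)`. -/
noncomputable def trace : TraceClass H →L[ℂ] ℂ :=
  LinearMap.mkContinuous
    { toFun := fun T => ∑' i, ⟪stdBasis H i, T.toCLM (stdBasis H i)⟫_ℂ
      map_add' := fun S T => by
        simp only [map_add, add_apply, inner_add_right]
        exact S.summable_norm_diag.of_norm.tsum_add T.summable_norm_diag.of_norm
      map_smul' := fun c T => by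
        simp only [map_smul, smul_apply, inner_smul_right, RingHom.id_apply, smul_eq_mul]
        exact tsum_mul_left } 1 fun T => by
    rw [one_mul]
    refine (norm_tsum_le_tsum_norm T.summable_norm_diag).trans ?_
    rw [TraceClass.norm_def]
    refine le_trans (le_of_eq ?_) (ENNReal.toReal_mono T.traceENorm_ne_top T.tsum_enorm_diag_le)
    rw [ENNReal.tsum_toReal_eq (by simp)]
    simp

theorem trace_apply (T : TraceClass H) :
    trace T = ∑' i, ⟪stdBasis H i, T.toCLM (stdBasis H i)⟫_ℂ := rfl

theorem traceENorm_rankOne_le (x y : H) :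
    traceENorm (InnerProductSpace.rankOne ℂ x y) ≤ (‖x‖ₑ ^ 2 + ‖y‖ₑ ^ 2) / 2 := by
  obtain ⟨U, hU, h⟩ := exists_abs_eq_mul (InnerProductSpace.rankOne ℂ x y)
  refine (traceENorm_le_tsum _).trans ?_
  rw [h]
  have h1 : ∀ i, ‖⟪stdBasis H i, (U * InnerProductSpace.rankOne ℂ x y) (stdBasis H i)⟫_ℂ‖ₑ
      ≤ (‖⟪stdBasis H i, U x⟫_ℂ‖ₑ ^ 2 + ‖⟪stdBasis H i, y⟫_ℂ‖ₑ ^ 2) / 2 := by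
    intro i
    have h0 : ‖⟪stdBasis H i, (U * InnerProductSpace.rankOne ℂ x y) (stdBasis H i)⟫_ℂ‖
        = ‖⟪stdBasis H i, U x⟫_ℂ‖ * ‖⟪stdBasis H i, y⟫_ℂ‖ := by
      simp only [mul_apply_eq_comp, InnerProductSpace.rankOne_apply, map_smul,
        inner_smul_right, norm_mul]
      rw [mul_comm, norm_inner_symm y]
    simp only [← ofReal_norm, h0, ← ENNReal.ofReal_pow (norm_nonneg _)]
    rw [← ENNReal.ofReal_add (by positivity) (by positivity)]
    have h2 : ‖⟪stdBasis H i, U x⟫_ℂ‖ * ‖⟪stdBasis H i, y⟫_ℂ‖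
        ≤ (‖⟪stdBasis H i, U x⟫_ℂ‖ ^ 2 + ‖⟪stdBasis H i, y⟫_ℂ‖ ^ 2) / 2 := by
      nlinarith [sq_nonneg (‖⟪stdBasis H i, U x⟫_ℂ‖ - ‖⟪stdBasis H i, y⟫_ℂ‖)]
    refine (ENNReal.ofReal_le_ofReal h2).trans ?_
    rw [ENNReal.ofReal_div_of_pos (by norm_num)]
    simp
  refine (ENNReal.tsum_le_tsum h1).trans ?_
  simp only [div_eq_mul_inv]
  rw [ENNReal.tsum_mul_right, ENNReal.tsum_add, ← enorm_sq_eq_tsum, ← enorm_sq_eq_tsum]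
  have h3 : ‖U x‖ₑ ≤ ‖x‖ₑ :=
    (U.le_opENorm x).trans (by
      calc _ ≤ 1 * ‖x‖ₑ := by gcongr; exact enorm_le_one_of hU
        _ = _ := one_mul _)
  gcongr

/-- The rank one operator `|x⟩⟨y|` as a trace class operator. -/
noncomputable def ketBra (x y : H) : TraceClass H :=
  ⟨InnerProductSpace.rankOne ℂ x y, ne_top_of_le_ne_top
    (ENNReal.div_ne_top (ENNReal.add_ne_top.2 ⟨by simp, by simp⟩) (by norm_num))
    (traceENorm_rankOne_le x y)⟩

@[simp] theorem toCLM_ketBra (x y : H) :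
    (ketBra x y).toCLM = InnerProductSpace.rankOne ℂ x y := rfl

theorem ketBra_add_left (x x' y : H) : ketBra (x + x') y = ketBra x y + ketBra x' y :=
  TraceClass.toCLM_injective (by simp)

theorem ketBra_add_right (x y y' : H) : ketBra x (y + y') = ketBra x y + ketBra x y' :=
  TraceClass.toCLM_injective (by simp)

theorem ketBra_smul_left (c : ℂ) (x y : H) : ketBra (c • x) y = c • ketBra x y :=
  TraceClass.toCLM_injective (by simp)

theorem ketBra_smul_right (c : ℂ) (x y : H) :
    ketBra x (c • y) = (starRingEnd ℂ) c • ketBra x y :=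
  TraceClass.toCLM_injective (by simp)

theorem norm_ketBra_le (x y : H) : ‖ketBra x y‖ ≤ ‖x‖ * ‖y‖ := by
  rcases eq_or_ne x 0 with rfl | hx
  · have : ketBra (0 : H) y = 0 := TraceClass.toCLM_injective (by simp)
    simp [this]
  rcases eq_or_ne y 0 with rfl | hy
  · have : ketBra x (0 : H) = 0 := TraceClass.toCLM_injective (by simp)
    simp [this]
  have hu : ∀ u v : H, ‖u‖ = 1 → ‖v‖ = 1 → ‖ketBra u v‖ ≤ 1 := by
    intro u v h1 h2
    have h := traceENorm_rankOne_le u v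
    rw [← ofReal_norm, ← ofReal_norm, h1, h2, ENNReal.ofReal_one, one_pow, one_add_one_eq_two,
      ENNReal.div_self (by norm_num) (by norm_num)] at h
    rw [TraceClass.norm_def, toCLM_ketBra]
    exact ENNReal.toReal_le_of_le_ofReal zero_le_one (by simpa using h)
  have hx' : ‖x‖ ≠ 0 := norm_ne_zero_iff.2 hx
  have hy' : ‖y‖ ≠ 0 := norm_ne_zero_iff.2 hy
  have h := hu ((‖x‖⁻¹ : ℂ) • x) ((‖y‖⁻¹ : ℂ) • y) (by simp [norm_smul, hx'])
    (by simp [norm_smul, hy'])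
  rw [ketBra_smul_left, ketBra_smul_right, norm_smul, norm_smul] at h
  simp only [norm_inv, Complex.norm_real, norm_norm, RCLike.norm_conj] at h
  rw [← mul_assoc, ← mul_inv, inv_mul_le_iff₀ (by positivity), mul_one] at h
  exact h

/-- The sesquilinear form `(v, w) ↦ f(|w⟩⟨v|)` of a bounded functional `f` on `𝒯(H)`. -/
noncomputable def functionalForm (f : TraceClass H →L[ℂ] ℂ) : H →L⋆[ℂ] H →L[ℂ] ℂ :=
  LinearMap.mkContinuous₂
    (LinearMap.mk₂'ₛₗ (starRingEnd ℂ) (RingHom.id ℂ) (fun v w => f (ketBra w v))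
      (fun v v' w => by rw [ketBra_add_right, map_add])
      (fun c v w => by rw [ketBra_smul_right, map_smul])
      (fun v w w' => by rw [ketBra_add_left, map_add])
      (fun c v w => by rw [ketBra_smul_left, map_smul]; rfl)) ‖f‖ fun v w => by
    refine (f.le_opNorm _).trans ?_
    rw [mul_assoc]
    gcongr
    exact (norm_ketBra_le w v).trans (le_of_eq (mul_comm _ _))

/-- The bounded operator `E` representing a bounded functional `f` on `𝒯(H)` under the duality
`𝒯(H)* = ℬ(H)`, that is `f(σ) = tr[σ E]`; it is given by `⟨v, E w⟩ = f(|w⟩⟨v|)`. -/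
noncomputable def dualOp (f : TraceClass H →L[ℂ] ℂ) : H →L[ℂ] H :=
  ContinuousLinearMap.adjoint (InnerProductSpace.continuousLinearMapOfBilin (functionalForm f))

theorem inner_dualOp (f : TraceClass H →L[ℂ] ℂ) (v w : H) :
    ⟪v, dualOp f w⟫_ℂ = f (ketBra w v) := by
  rw [dualOp, ContinuousLinearMap.adjoint_inner_right,
    InnerProductSpace.continuousLinearMapOfBilin_apply]
  rfl

end TraceClassSpace

section Instruments

variable {H : Type*} [NormedAddCommGroup H] [InnerProductSpace ℂ H] [CompleteSpace H]

/-- A (positive) instrument with outcomes in `ι`: a family of positive bounded linear maps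
`M_m : 𝒯(H) → 𝒯(H)` whose sum converges pointwise in trace norm and preserves the trace. -/
structure Instrument (ι : Type*) (H : Type*) [NormedAddCommGroup H] [InnerProductSpace ℂ H]
    [CompleteSpace H] where
  /-- The operation `M_m` conditioned on the outcome `m`. -/
  op : ι → TraceClass H →L[ℂ] TraceClass H
  positive : ∀ m (σ : TraceClass H), σ.toCLM.IsPositive → (op m σ).toCLM.IsPositive
  summable : ∀ σ : TraceClass H, Summable fun m => op m σ
  trace_preserving : ∀ σ : TraceClass H, trace (∑' m, op m σ) = trace σ

/-- The state space `𝒮(H)`: positive trace class operators of trace one. -/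
def IsState (ρ : TraceClass H) : Prop := ρ.toCLM.IsPositive ∧ trace ρ = 1

/-- `A ∘_α B = α A B + (1 - α) B A` for bounded operators. -/
noncomputable def alphaProd (α : ℝ) (A B : H →L[ℂ] H) : H →L[ℂ] H :=
  (α : ℂ) • (A * B) + (1 - (α : ℂ)) • (B * A)

/-- `T ∘_α B = α T B + (1 - α) B T` for a trace class operator `T` and a bounded operator `B`. -/
noncomputable def TraceClass.alphaProd (α : ℝ) (T : TraceClass H) (B : H →L[ℂ] H) :
    TraceClass H :=
  (α : ℂ) • (T * B : TraceClass H) + (1 - (α : ℂ)) • (B * T : TraceClass H)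

namespace Instrument

variable {ι κ : Type*}

/-- The non-selective process `Λ_M(σ) = ∑_m M_m(σ)` (sum in trace norm). -/
noncomputable def nonselective (M : Instrument ι H) (σ : TraceClass H) : TraceClass H :=
  ∑' m, M.op m σ

/-- The invasiveness `Inv_M(ρ) = ‖Λ_M(ρ) - ρ‖₁`. -/
noncomputable def invasiveness (M : Instrument ι H) (ρ : TraceClass H) : ℝ :=
  ‖M.nonselective ρ - ρ‖

/-- The POVM `E_M` of `M`: `E_M(m)` is the operator with `tr[σ E_M(m)] = tr[M_m(σ)]`. -/
noncomputable def povm (M : Instrument ι H) (m : ι) : H →L[ℂ] H :=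
  dualOp (trace ∘L M.op m)

/-- `∑_{m' ≠ m} E_M(m')`, the sum taken in the weak operator topology (for infinitely many outcomes
a POVM need not converge in operator norm). -/
noncomputable def povmOthers (M : Instrument ι H) (m : ι) : H →L[ℂ] H :=
  (∑' m' : {m' : ι // m' ≠ m},
    (ContinuousLinearMapWOT.ofCLM (M.povm m') : H →WOT[ℂ] H)).toCLM

/-- `∑_{m' ≠ m} M_{m'}(σ)` (sum in trace norm). -/
noncomputable def opOthers (M : Instrument ι H) (m : ι) (σ : TraceClass H) : TraceClass H :=
  ∑' m' : {m' : ι // m' ≠ m}, M.op m' σ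

/-- The operational joint probability of obtaining `m` and then `n` in the sequential measurement
of `M` followed by `N` on the state `ρ`. -/
noncomputable def jointProb (M : Instrument ι H) (N : Instrument κ H) (ρ : TraceClass H)
    (m : ι) (n : κ) : ℂ :=
  trace (N.op n (M.op m ρ))

/-- The algebraic quasi-joint probability
`tr[ρ (α E_M(m) E_N(n) + (1 - α) E_N(n) E_M(m))]`. -/
noncomputable def quasiProb (M : Instrument ι H) (N : Instrument κ H) (α : ℝ) (ρ : TraceClass H)
    (m : ι) (n : κ) : ℂ :=
  trace (ρ * alphaProd α (M.povm m) (N.povm n) : TraceClass H)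

end Instrument

end Instruments

end QuantumCorr

namespace QuantumCorr

/-! ### Density of finite-rank operators in trace norm -/

section Density

variable {H : Type*} [NormedAddCommGroup H] [InnerProductSpace ℂ H] [CompleteSpace H]

/-! Write `Λ` for the non-selective process of `M`, `E`, `F` for the effects of `M`, `N` at `m`,
`n`, and `∘` for `∘_α`. Duality gives `tr N_n(M_m(ρ)) = tr[M_m(ρ) F]`, and cyclicity gives `tr[T (E
∘ F)] = tr[(T ∘ E) F]`. Adding and subtracting `tr[Λ(ρ) (E ∘ F)]` therefore splits the difference of
the two probabilities exactly into `tr[(Λ(ρ) - ρ)(E ∘ F)] + tr[(M_m(ρ) - Λ(ρ) ∘ E) F]`. Since the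
other effects sum to `1 - E` and the other operations to `Λ(ρ) - M_m(ρ)`, the bracket in the second
trace is the operator in the claim: the two copies of `M_m(ρ) ∘ E` cancel. This is
`jointProb_sub_quasiProb`; the bound is then `|tr(TA)| ≤ ‖A‖ ‖T‖₁` (`norm_trace_mul_le`) applied to
each trace.

In infinite dimension, the work lies in cyclicity (`trace_mul_comm`) and duality
(`trace_mul_dualOp`). Both equate bounded functionals on the trace class, so they need checking only
on operators `|x⟩⟨y|`, whose span is dense in trace norm (`dense_span_ketBra`). -/

/-- With `|A B* B| = V A B* B` and `V` a contraction, each diagonal entry is the inner product of `B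
(VA)* eᵢ` and `B eᵢ`; the arithmetic-geometric mean inequality leaves two squared Hilbert-Schmidt
norms, each at most `hsq B`. This turns a trace-norm error into a Hilbert-Schmidt tail. -/
theorem traceENorm_mul_star_mul_le (A B : H →L[ℂ] H) (hA : ‖A‖ ≤ 1) :
    traceENorm (A * (star B * B)) ≤ hsq B := by
  obtain ⟨V, hV, hR⟩ := exists_abs_eq_mul (A * (star B * B))
  refine (traceENorm_le_tsum _).trans ?_
  have hVA : ‖star (V * A)‖ₑ ≤ 1 := enorm_le_one_of <| by
    rw [norm_star]; exact (norm_mul_le _ _).trans (mul_le_one₀ hV (norm_nonneg _) hA)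
  have h1 : ∀ i, ‖⟪stdBasis H i, CFC.abs (A * (star B * B)) (stdBasis H i)⟫_ℂ‖ₑ
      ≤ (‖(B * star (V * A)) (stdBasis H i)‖ₑ ^ 2 + ‖B (stdBasis H i)‖ₑ ^ 2) / 2 := by
    intro i
    have h2 : CFC.abs (A * (star B * B)) = star (B * star (V * A)) * B := by
      rw [hR, star_mul, star_star]; simp only [mul_assoc]
    rw [h2, mul_apply_eq_comp, ContinuousLinearMap.star_eq_adjoint (B * star (V * A)),
      ContinuousLinearMap.adjoint_inner_right]
    set u := (B * star (V * A)) (stdBasis H i)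
    set v := B (stdBasis H i)
    have h := norm_inner_le_norm (𝕜 := ℂ) u v
    have h2 : ‖⟪u, v⟫_ℂ‖ ≤ (‖u‖ ^ 2 + ‖v‖ ^ 2) / 2 := by nlinarith [sq_nonneg (‖u‖ - ‖v‖)]
    simp only [← ofReal_norm, ← ENNReal.ofReal_pow (norm_nonneg _)]
    rw [← ENNReal.ofReal_add (by positivity) (by positivity)]
    refine (ENNReal.ofReal_le_ofReal h2).trans ?_
    rw [ENNReal.ofReal_div_of_pos (by norm_num)]
    simp
  refine (ENNReal.tsum_le_tsum h1).trans ?_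
  simp only [div_eq_mul_inv]
  rw [ENNReal.tsum_mul_right, ENNReal.tsum_add]
  calc (hsq (B * star (V * A)) + hsq B) * 2⁻¹ ≤ (1 ^ 2 * hsq B + hsq B) * 2⁻¹ := by
        gcongr
        refine (hsq_mul_right _ _).trans ?_
        gcongr
    _ = hsq B * (2 * 2⁻¹) := by ring
    _ = hsq B := by rw [ENNReal.mul_inv_cancel (by norm_num) (by norm_num), mul_one]

/-- The orthogonal projection onto the span of finitely many vectors of the standard basis. -/
noncomputable def basisProj (F : Finset (basisIdx H)) : H →L[ℂ] H :=
  ∑ i ∈ F, InnerProductSpace.rankOne ℂ (stdBasis H i) (stdBasis H i)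

open Classical in
theorem basisProj_apply_basis (F : Finset (basisIdx H)) (i : basisIdx H) :
    basisProj F (stdBasis H i) = if i ∈ F then stdBasis H i else 0 := by
  simp [basisProj, orthonormal_iff_ite.1 (stdBasis H).orthonormal]

theorem star_basisProj (F : Finset (basisIdx H)) : star (basisProj F) = basisProj F := by
  simp [basisProj, ContinuousLinearMap.star_eq_adjoint]

theorem mul_basisProj_mul (A B : H →L[ℂ] H) (F : Finset (basisIdx H)) :
    A * basisProj F * B
      = ∑ i ∈ F, InnerProductSpace.rankOne ℂ (A (stdBasis H i)) (star B (stdBasis H i)) := by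
  rw [basisProj, Finset.mul_sum, Finset.sum_mul]
  refine Finset.sum_congr rfl fun i _ => ?_
  ext x
  simp [ContinuousLinearMap.star_eq_adjoint, ContinuousLinearMap.adjoint_inner_left]

theorem basisProj_mul_self (F : Finset (basisIdx H)) : basisProj F * basisProj F = basisProj F := by
  classical
  have h := mul_basisProj_mul (basisProj F) 1 F
  rw [mul_one] at h
  rw [h, basisProj]
  refine Finset.sum_congr rfl fun i hi => ?_
  rw [← basisProj, basisProj_apply_basis, if_pos hi, star_one]
  rfl

/-- The factor `1 - basisProj F` kills the basis vectors in `F` and fixes the others, so what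
remains is the tail of the convergent sum `hsq S`. -/
theorem tendsto_hsq_sub_basisProj (S : H →L[ℂ] H) (hS : hsq S ≠ ∞) :
    Filter.Tendsto (fun F : Finset (basisIdx H) => hsq (S * (1 - basisProj F))) Filter.atTop
      (nhds 0) := by
  classical
  convert ENNReal.tendsto_tsum_compl_atTop_zero hS using 2 with F
  refine Eq.trans (tsum_congr fun i => ?_)
    (tsum_subtype {i | i ∉ F} fun i => ‖S (stdBasis H i)‖ₑ ^ 2).symm
  by_cases hi : i ∈ F <;> simp [basisProj_apply_basis, hi]

/-- Write `T = U S S` with `S = √|T|` Hilbert-Schmidt, and insert a finite basis projection `P`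
between the two factors `S`. The result has finite rank, and the error `U S (1 - P) S` has trace
norm at most `hsq ((1 - P) S)`. -/
theorem dense_span_ketBra :
    Dense (Submodule.span ℂ (Set.range fun p : H × H => ketBra p.1 p.2) :
      Set (TraceClass H)) := by
  intro T
  rw [Metric.mem_closure_iff]
  intro ε hε
  obtain ⟨U, hU, hT⟩ := exists_eq_mul_abs T.toCLM
  set S := rootAbs T.toCLM with hSdef
  have hS : hsq S ≠ ∞ := by rw [hSdef, ← traceENorm_eq_hsq]; exact T.traceENorm_ne_top
  obtain ⟨F, hF⟩ := ((tendsto_hsq_sub_basisProj S hS).eventually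
    (gt_mem_nhds (ENNReal.ofReal_pos.2 hε))).exists
  -- This is `U S P S`, expanded by `mul_basisProj_mul`.
  refine ⟨∑ i ∈ F, ketBra ((U * S) (stdBasis H i)) (star S (stdBasis H i)),
    Submodule.sum_mem _ fun i _ => Submodule.subset_span ⟨(_, _), rfl⟩, ?_⟩
  have hQ : (1 - basisProj F) * (1 - basisProj F) = (1 - basisProj F : H →L[ℂ] H) := by
    rw [mul_sub, sub_mul, sub_mul, basisProj_mul_self]; simp
  have hQs : star (1 - basisProj F : H →L[ℂ] H) = 1 - basisProj F := by
    rw [star_sub, star_one, star_basisProj]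
  have hSs : star S = S := rootAbs_star _
  have h1 : T.toCLM - ∑ i ∈ F, InnerProductSpace.rankOne ℂ ((U * S) (stdBasis H i))
        (star S (stdBasis H i))
      = U * (star ((1 - basisProj F) * S) * ((1 - basisProj F) * S)) := by
    rw [← mul_basisProj_mul, star_mul, hQs, hSs]
    calc _ = U * (S * S) - U * S * basisProj F * S := by rw [hSdef, rootAbs_mul, ← hT]
      _ = U * (S * ((1 - basisProj F) * S)) := by noncomm_ring
      _ = U * (S * (((1 - basisProj F) * (1 - basisProj F)) * S)) := by rw [hQ]
      _ = _ := by simp only [mul_assoc]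
  -- The tail estimate has the projection on the right; taking adjoints moves it there.
  have h2 : hsq ((1 - basisProj F) * S) = hsq (S * (1 - basisProj F)) := by
    rw [← hsq_adjoint, star_mul, hQs, hSs]
  rw [dist_eq_norm, TraceClass.norm_def, map_sub, map_sum]
  simp only [toCLM_ketBra]
  rw [h1]
  have h3 := (traceENorm_mul_star_mul_le U ((1 - basisProj F) * S) hU).trans_lt (h2 ▸ hF)
  exact (ENNReal.toReal_lt_of_lt_ofReal h3)

theorem ext_ketBra {f g : TraceClass H →L[ℂ] ℂ} (h : ∀ x y, f (ketBra x y) = g (ketBra x y)) :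
    f = g :=
  ContinuousLinearMap.ext_on dense_span_ketBra (by rintro _ ⟨p, rfl⟩; exact h _ _)

end Density

/-! ### Norm bounds, cyclicity and duality for the trace -/

section Trace

variable {H : Type*} [NormedAddCommGroup H] [InnerProductSpace ℂ H] [CompleteSpace H]

theorem trace_ketBra (x y : H) : trace (ketBra x y) = ⟪y, x⟫_ℂ := by
  rw [trace_apply, ← (stdBasis H).tsum_inner_mul_inner y x]
  refine tsum_congr fun i => ?_
  simp

theorem TraceClass.norm_lmul_le (A : H →L[ℂ] H) (T : TraceClass H) :
    ‖(A * T : TraceClass H)‖ ≤ ‖A‖ * ‖T‖ := by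
  have h1 : ∀ B : H →L[ℂ] H, ‖B‖ ≤ 1 → ‖(B * T : TraceClass H)‖ ≤ ‖T‖ := by
    intro B hB
    rw [norm_def, norm_def, toCLM_lmul]
    refine ENNReal.toReal_mono T.traceENorm_ne_top ?_
    obtain ⟨V, hV, h⟩ := exists_abs_eq_mul (B * T.toCLM)
    refine (traceENorm_le_tsum _).trans ?_
    rw [h, ← mul_assoc]
    exact tsum_enorm_inner_le' _ _ ((norm_mul_le _ _).trans (mul_le_one₀ hV (norm_nonneg _) hB))
  rcases eq_or_ne A 0 with rfl | hA
  · have : ((0 : H →L[ℂ] H) * T : TraceClass H) = 0 := toCLM_injective (by simp)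
    simp [this]
  have hA' : ‖A‖ ≠ 0 := norm_ne_zero_iff.2 hA
  have hc : (‖A‖ : ℂ) ≠ 0 := Complex.ofReal_ne_zero.2 hA'
  have h2 : (A * T : TraceClass H) = (‖A‖ : ℂ) • (((‖A‖ : ℂ)⁻¹ • A) * T : TraceClass H) :=
    toCLM_injective (by
      simp only [map_smul, toCLM_lmul, smul_mul_assoc, smul_smul, mul_inv_cancel₀ hc, one_smul])
  rw [h2, norm_smul]
  simp only [Complex.norm_real, norm_norm]
  gcongr
  exact h1 _ (by simp [norm_smul, hA'])

/-- Left multiplication by a bounded operator on the trace class. -/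
noncomputable def TraceClass.lmulCLM (A : H →L[ℂ] H) : TraceClass H →L[ℂ] TraceClass H :=
  LinearMap.mkContinuous
    { toFun := fun T => (A * T : TraceClass H)
      map_add' := fun S T => toCLM_injective (by simp [mul_add])
      map_smul' := fun c T => toCLM_injective (by simp) } ‖A‖ (norm_lmul_le A)

/-- Here the contraction sits on the wrong side for `tsum_enorm_inner_le'`, so `T` is
polar-decomposed as well: `|T B| = (V U) |T| B`. The bound for such sandwiches involves the mean of
squared norms rather than their product, hence the reduction to `‖B‖ ≤ 1` by scaling. -/
theorem TraceClass.norm_rmul_le (T : TraceClass H) (A : H →L[ℂ] H) :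
    ‖(T * A : TraceClass H)‖ ≤ ‖A‖ * ‖T‖ := by
  have h1 : ∀ B : H →L[ℂ] H, ‖B‖ ≤ 1 → ‖(T * B : TraceClass H)‖ ≤ ‖T‖ := by
    intro B hB
    rw [norm_def, norm_def, toCLM_rmul]
    refine ENNReal.toReal_mono T.traceENorm_ne_top ?_
    obtain ⟨V, hV, h⟩ := exists_abs_eq_mul (T.toCLM * B)
    obtain ⟨U, hU, hT⟩ := exists_eq_mul_abs T.toCLM
    refine (traceENorm_le_tsum _).trans ?_
    have h3 : CFC.abs (T.toCLM * B) = V * U * CFC.abs T.toCLM * B := by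
      rw [h]; conv_lhs => rw [hT]
      simp only [mul_assoc]
    rw [h3]
    refine (tsum_enorm_inner_le _ _ _).trans ?_
    have h4 : ‖V * U‖ₑ ≤ 1 :=
      enorm_le_one_of ((norm_mul_le _ _).trans (mul_le_one₀ hV (norm_nonneg _) hU))
    calc _ ≤ ((1 : ℝ≥0∞) ^ 2 + 1 ^ 2) / 2 * traceENorm T.toCLM := by
          gcongr; exact enorm_le_one_of hB
      _ = traceENorm T.toCLM := by
        rw [one_pow, one_add_one_eq_two, ENNReal.div_self (by norm_num) (by norm_num), one_mul]
  rcases eq_or_ne A 0 with rfl | hA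
  · have : (T * (0 : H →L[ℂ] H) : TraceClass H) = 0 := toCLM_injective (by simp)
    simp [this]
  have hA' : ‖A‖ ≠ 0 := norm_ne_zero_iff.2 hA
  have hc : (‖A‖ : ℂ) ≠ 0 := Complex.ofReal_ne_zero.2 hA'
  have h2 : (T * A : TraceClass H) = (‖A‖ : ℂ) • (T * ((‖A‖ : ℂ)⁻¹ • A) : TraceClass H) :=
    toCLM_injective (by
      simp only [map_smul, toCLM_rmul, mul_smul_comm, smul_smul, mul_inv_cancel₀ hc, one_smul])
  rw [h2, norm_smul]
  simp only [Complex.norm_real, norm_norm]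
  gcongr
  exact h1 _ (by simp [norm_smul, hA'])

/-- Right multiplication by a bounded operator on the trace class. -/
noncomputable def TraceClass.rmulCLM (A : H →L[ℂ] H) : TraceClass H →L[ℂ] TraceClass H :=
  LinearMap.mkContinuous
    { toFun := fun T => (T * A : TraceClass H)
      map_add' := fun S T => toCLM_injective (by simp [add_mul])
      map_smul' := fun c T => toCLM_injective (by simp) } ‖A‖ fun T => norm_rmul_le T A

theorem TraceClass.lmulCLM_apply (A : H →L[ℂ] H) (T : TraceClass H) :
    lmulCLM A T = (A * T : TraceClass H) := rfl

theorem TraceClass.rmulCLM_apply (A : H →L[ℂ] H) (T : TraceClass H) :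
    rmulCLM A T = (T * A : TraceClass H) := rfl

theorem lmul_ketBra (A : H →L[ℂ] H) (x y : H) :
    (A * ketBra x y : TraceClass H) = ketBra (A x) y :=
  TraceClass.toCLM_injective (by ext z; simp)

theorem rmul_ketBra (A : H →L[ℂ] H) (x y : H) :
    (ketBra x y * A : TraceClass H) = ketBra x (star A y) :=
  TraceClass.toCLM_injective <| by
    ext z; simp [ContinuousLinearMap.star_eq_adjoint, ContinuousLinearMap.adjoint_inner_left]

/-- On `|x⟩⟨y|` both sides equal `⟪y, A x⟫`; density does the rest. -/
theorem trace_mul_comm (T : TraceClass H) (A : H →L[ℂ] H) :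
    trace (T * A : TraceClass H) = trace (A * T : TraceClass H) := by
  have h : trace ∘L TraceClass.rmulCLM A = trace ∘L TraceClass.lmulCLM A := ext_ketBra fun x y => by
    simp only [ContinuousLinearMap.comp_apply, TraceClass.lmulCLM_apply, TraceClass.rmulCLM_apply,
      lmul_ketBra, rmul_ketBra, trace_ketBra]
    rw [ContinuousLinearMap.star_eq_adjoint, ContinuousLinearMap.adjoint_inner_left]
  exact congrArg (fun f => f T) h

theorem trace_mul_dualOp (f : TraceClass H →L[ℂ] ℂ) (σ : TraceClass H) :
    trace (σ * dualOp f : TraceClass H) = f σ := by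
  have h : trace ∘L TraceClass.rmulCLM (dualOp f) = f := ext_ketBra fun x y => by
    simp only [ContinuousLinearMap.comp_apply, TraceClass.rmulCLM_apply]
    rw [trace_mul_comm, lmul_ketBra, trace_ketBra, inner_dualOp]
  exact congrArg (fun g => g σ) h

theorem norm_trace_le (T : TraceClass H) : ‖trace T‖ ≤ ‖T‖ := by
  have h : ‖(trace : TraceClass H →L[ℂ] ℂ)‖ ≤ 1 := LinearMap.mkContinuous_norm_le _ zero_le_one _
  exact (trace.le_opNorm T).trans (mul_le_of_le_one_left (norm_nonneg _) h)

theorem norm_trace_mul_le (T : TraceClass H) (A : H →L[ℂ] H) :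
    ‖trace (T * A : TraceClass H)‖ ≤ ‖A‖ * ‖T‖ :=
  (norm_trace_le _).trans (T.norm_rmul_le A)

/-- Only the term `T B A` changes order: cyclicity carries its last factor `A` to the front, giving
`A T B`. -/
theorem trace_mul_alphaProd (α : ℝ) (T : TraceClass H) (A B : H →L[ℂ] H) :
    trace (T * alphaProd α A B : TraceClass H) = trace (T.alphaProd α A * B : TraceClass H) := by
  have h1 : (T * alphaProd α A B : TraceClass H)
      = (α : ℂ) • ((T * A : TraceClass H) * B : TraceClass H)
        + (1 - (α : ℂ)) • ((T * B : TraceClass H) * A : TraceClass H) :=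
    TraceClass.toCLM_injective (by simp [alphaProd, mul_add, mul_assoc])
  have h2 : (T.alphaProd α A * B : TraceClass H)
      = (α : ℂ) • ((T * A : TraceClass H) * B : TraceClass H)
        + (1 - (α : ℂ)) • (A * (T * B : TraceClass H) : TraceClass H) :=
    TraceClass.toCLM_injective (by simp [TraceClass.alphaProd, add_mul, mul_assoc])
  rw [h1, h2, map_add, map_add, map_smul, map_smul, map_smul, trace_mul_comm (T * B) A]

end Trace

/-! ### Sums over outcomes and the splitting identity -/

section Instruments

variable {H : Type*} [NormedAddCommGroup H] [InnerProductSpace ℂ H] [CompleteSpace H]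

theorem hasSum_subtype_ne {ι G : Type*} [AddCommGroup G] [TopologicalSpace G]
    [IsTopologicalAddGroup G] {f : ι → G} {a : G} (h : HasSum f a) (m : ι) :
    HasSum (fun m' : {m' : ι // m' ≠ m} => f m') (a - f m) := by
  classical
  have h1 : HasSum (fun m' : {x : ι // x ∉ ({m} : Finset ι)} => f m') (a - f m) := by
    rw [Finset.hasSum_compl_iff]; simpa using h
  exact (Equiv.subtypeEquivRight (p := fun m' => m' ≠ m)
    (q := fun x => x ∉ ({m} : Finset ι)) (by simp)).hasSum_iff.2 h1

namespace Instrument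

variable {ι κ : Type*}

theorem hasSum_op (M : Instrument ι H) (σ : TraceClass H) :
    HasSum (fun m => M.op m σ) (M.nonselective σ) := (M.summable σ).hasSum

theorem trace_mul_povm (M : Instrument ι H) (m : ι) (σ : TraceClass H) :
    trace (σ * M.povm m : TraceClass H) = trace (M.op m σ) :=
  trace_mul_dualOp _ σ

theorem opOthers_eq (M : Instrument ι H) (m : ι) (σ : TraceClass H) :
    M.opOthers m σ = M.nonselective σ - M.op m σ :=
  (hasSum_subtype_ne (M.hasSum_op σ) m).tsum_eq

/-- Weak convergence is tested on `⟪y, E_M(m) x⟫ = tr M_m(|x⟩⟨y|)`; continuity of the trace and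
trace preservation sum these to `tr |x⟩⟨y| = ⟪y, x⟫`. -/
theorem hasSum_povm (M : Instrument ι H) :
    HasSum (fun m => (ContinuousLinearMapWOT.ofCLM (M.povm m) : H →WOT[ℂ] H))
      (ContinuousLinearMapWOT.ofCLM 1) := by
  rw [HasSum, ContinuousLinearMapWOT.tendsto_iff_forall_inner_apply_tendsto]
  intro x y
  have h : HasSum (fun m => ⟪y, M.povm m x⟫_ℂ) ⟪y, x⟫_ℂ := by
    have h1 := (M.hasSum_op (ketBra x y)).mapL trace
    rw [nonselective, M.trace_preserving, trace_ketBra] at h1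
    simpa only [povm, inner_dualOp, ContinuousLinearMap.comp_apply] using h1
  have h2 : ∀ s : Finset ι, ⟪y, (∑ m ∈ s, ContinuousLinearMapWOT.ofCLM (M.povm m) : H →WOT[ℂ] H) x⟫_ℂ
      = ∑ m ∈ s, ⟪y, M.povm m x⟫_ℂ := fun s => by
    induction s using Finset.cons_induction with
    | empty => simp
    | cons a s ha ih => simp [Finset.sum_cons, ih]
  simp only [h2]
  exact h

theorem povmOthers_eq (M : Instrument ι H) (m : ι) : M.povmOthers m = 1 - M.povm m := by
  rw [povmOthers, (hasSum_subtype_ne M.hasSum_povm m).tsum_eq]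
  rfl

/-- The weights `α` and `1 - α` add to one, so `M_m(ρ) ∘_α 1 = M_m(ρ)`, while `M_m(ρ) ∘_α E_M(m)`
occurs with both signs. -/
theorem alphaProd_povmOthers_sub (M : Instrument ι H) (α : ℝ) (ρ : TraceClass H) (m : ι) :
    (M.op m ρ).alphaProd α (M.povmOthers m) - (M.opOthers m ρ).alphaProd α (M.povm m)
      = M.op m ρ - (M.nonselective ρ).alphaProd α (M.povm m) := by
  rw [povmOthers_eq, opOthers_eq]
  refine TraceClass.toCLM_injective ?_
  simp only [TraceClass.alphaProd, map_sub, map_add, map_smul, TraceClass.toCLM_lmul,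
    TraceClass.toCLM_rmul, mul_sub, sub_mul, mul_one, one_mul]
  module

theorem jointProb_sub_quasiProb (M : Instrument ι H) (N : Instrument κ H) (α : ℝ)
    (ρ : TraceClass H) (m : ι) (n : κ) :
    M.jointProb N ρ m n - M.quasiProb N α ρ m n
      = trace ((M.nonselective ρ - ρ) * alphaProd α (M.povm m) (N.povm n) : TraceClass H)
        + trace (((M.op m ρ).alphaProd α (M.povmOthers m)
            - (M.opOthers m ρ).alphaProd α (M.povm m)) * N.povm n : TraceClass H) := by
  have hsub : ∀ (S T : TraceClass H) (A : H →L[ℂ] H),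
      trace ((S - T) * A : TraceClass H)
        = trace (S * A : TraceClass H) - trace (T * A : TraceClass H) := fun S T A => by
    simp only [← TraceClass.rmulCLM_apply, map_sub]
  -- Moving `∘_α` onto `Λ_M(ρ)` makes its contributions to the two traces identical up to sign, so
  -- they cancel.
  rw [alphaProd_povmOthers_sub, hsub, hsub, trace_mul_alphaProd α (M.nonselective ρ), jointProb,
    quasiProb, N.trace_mul_povm n (M.op m ρ)]
  ring

end Instrument

end Instruments

end QuantumCorr

theorem mainTheorem12 {H : Type*} [NormedAddCommGroup H] [InnerProductSpace ℂ H] [CompleteSpace H]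
    {ι κ : Type*} (M : QuantumCorr.Instrument ι H) (N : QuantumCorr.Instrument κ H)
    (α : ℝ) (ρ : QuantumCorr.TraceClass H) (hρ : QuantumCorr.IsState ρ) (m : ι) (n : κ) :
    ‖M.jointProb N ρ m n - M.quasiProb N α ρ m n‖ ≤
      ‖QuantumCorr.alphaProd α (M.povm m) (N.povm n)‖ * M.invasiveness ρ
      + ‖N.povm n‖ *
        ‖(M.op m ρ).alphaProd α (M.povmOthers m) - (M.opOthers m ρ).alphaProd α (M.povm m)‖ := by
  rw [M.jointProb_sub_quasiProb N α ρ m n]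
  exact (norm_add_le _ _).trans (add_le_add (QuantumCorr.norm_trace_mul_le _ _)
    (QuantumCorr.norm_trace_mul_le _ _))
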